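/- Let $d\ge 1$ and let $\mathbb P_d$ be the set of real symmetric positive definite $d\times d$ matrices with the affine-invariant Riemannian metric $\langle U,V\rangle_X=\operatorname{tr}(X^{-1}UX^{-1}V)$, where $X\in\mathbb P_d$ and $U,V$ are symmetric. A set $S\subseteq\mathbb P_d$ is geodesically convex if any two points of $S$ are joined by a geodesic segment $\gamma:[0,1]\to\mathbb P_d$ of this metric with image in $S$. A function $f$ on $S$ is geodesically convex if $S$ is geodesically convex and $f\circ\gamma:[0,1]\to\mathbb R$ is convex for every geodesic segment $\gamma:[0,1]\to\mathbb P_d$ with image in $S$ and $\gamma(0)\ne\gamma(1)$; for matrix-valued $f$, convexity of $f\circ\gamma$ is understood in the Löwner order, in which $A\preceq B$ means that $B-A$ is positive semidefinite. Let $h,h_1,\dots,h_n\in\mathbb R^d$ and $Y\in\mathbb P_d$ be fixed. Then each of the following functions of $X$ is geodesically convex on $\mathbb P_d$: 1. $f(X)=\log\left(\sum_{i=1}^n h_i^\top X h_i\right)$, provided that at least one $h_i$ is nonzero; 2. $f(X)=\log\det X$; 3. $f(X)=h^\top X h$; 4. $f(X)=\operatorname{tr}X$; 5. $f(X)=\delta_S^2(X,Y):=\log\det\left(\frac{X+Y}{2}\right)-\frac12\log\det(XY)$;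 6. $f(X)=\left\|\log\left(Y^{-1/2}XY^{-1/2}\right)\right\|_F^2$, where $\|\cdot\|_F$ is the Frobenius norm; 7. $f(X)=\sup\{y^\top X y : y\in\mathbb R^d,\ \|y\|_2=1\}$, where the supremum is finite; 8. $f(X)=X^{-1}$ (in the Löwner order). -/

import Mathlib

open scoped Matrix MatrixOrder

namespace SPD

/-- The manifold of real symmetric positive definite `d × d` matrices. It is an open subset of the
space of symmetric matrices, which serves as a global chart and as the tangent space everywhere. -/
def manifold (d : ℕ) : Set (Matrix (Fin d) (Fin d) ℝ) := {X | X.PosDef}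

/-- The affine-invariant Riemannian metric `⟨U, V⟩_X = tr (X⁻¹ U X⁻¹ V)`. -/
noncomputable def metric {d : ℕ} (X U V : Matrix (Fin d) (Fin d) ℝ) : ℝ :=
  (X⁻¹ * U * X⁻¹ * V).trace

/-- The derivative of the metric coefficient `X ↦ ⟨U, V⟩_X` in the direction `Z`, where `U` and `V`
are constant vector fields in the global chart. -/
noncomputable def metricDeriv {d : ℕ} (X Z U V : Matrix (Fin d) (Fin d) ℝ) : ℝ :=
  deriv (fun s : ℝ => metric (X + s • Z) U V) 0

/-- The Christoffel symbols of the first kind of the Levi-Civita connection of the metric: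
`christoffel X U V W = ⟨∇_U V, W⟩_X` for constant vector fields `U`, `V`, `W`. -/
noncomputable def christoffel {d : ℕ} (X U V W : Matrix (Fin d) (Fin d) ℝ) : ℝ :=
  (1 / 2) * (metricDeriv X U V W + metricDeriv X V U W - metricDeriv X W U V)

/-- The velocity, computed entrywise, of a curve parametrized by `[0, 1]` (one-sided derivatives at
the end points). -/
noncomputable def velocity {d : ℕ} (γ : ℝ → Matrix (Fin d) (Fin d) ℝ) (t : ℝ) :
    Matrix (Fin d) (Fin d) ℝ :=
  Matrix.of fun i j => derivWithin (fun s => γ s i j) (Set.Icc 0 1) t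

/-- `γ : [0, 1] → manifold d` is a geodesic segment: a `C²` curve with vanishing covariant
acceleration, `⟨γ'' + Γ(γ', γ'), W⟩_γ = 0` for every tangent vector (symmetric matrix) `W`.
Values of `γ` outside `[0, 1]` play no role. -/
structure IsGeodesicSegment {d : ℕ} (γ : ℝ → Matrix (Fin d) (Fin d) ℝ) : Prop where
  mem_manifold : ∀ t ∈ Set.Icc (0 : ℝ) 1, γ t ∈ manifold d
  contDiffOn : ∀ i j, ContDiffOn ℝ 2 (fun t => γ t i j) (Set.Icc 0 1)
  geodesic_equation : ∀ t ∈ Set.Icc (0 : ℝ) 1, ∀ W : Matrix (Fin d) (Fin d) ℝ, W.IsSymm →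
    metric (γ t) (velocity (velocity γ) t) W +
      christoffel (γ t) (velocity γ t) (velocity γ t) W = 0

/-- Geodesic convexity of a subset of the manifold. -/
def IsGConvexSet {d : ℕ} (S : Set (Matrix (Fin d) (Fin d) ℝ)) : Prop :=
  S ⊆ manifold d ∧ ∀ A ∈ S, ∀ B ∈ S, ∃ γ : ℝ → Matrix (Fin d) (Fin d) ℝ,
    IsGeodesicSegment γ ∧ γ 0 = A ∧ γ 1 = B ∧ ∀ t ∈ Set.Icc (0 : ℝ) 1, γ t ∈ S

/-- Geodesic convexity of a function on `S`, with values in `ℝ` or, more generally, in a partially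
ordered real vector space: `S` is geodesically convex, and the function is convex in the Euclidean
sense along every nonconstant geodesic segment in `S`. -/
def GConvexOn {d : ℕ} {β : Type*} [AddCommMonoid β] [PartialOrder β] [SMul ℝ β]
    (S : Set (Matrix (Fin d) (Fin d) ℝ)) (f : Matrix (Fin d) (Fin d) ℝ → β) : Prop :=
  IsGConvexSet S ∧ ∀ γ : ℝ → Matrix (Fin d) (Fin d) ℝ, IsGeodesicSegment γ →
    (∀ t ∈ Set.Icc (0 : ℝ) 1, γ t ∈ S) → γ 0 ≠ γ 1 →
      ConvexOn ℝ (Set.Icc (0 : ℝ) 1) (fun t => f (γ t))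

/-- The real power `A ^ r` of a symmetric positive definite matrix (spectral calculus). -/
noncomputable def rpow {d : ℕ} (A : Matrix (Fin d) (Fin d) ℝ) (r : ℝ) :
    Matrix (Fin d) (Fin d) ℝ :=
  cfc (fun x : ℝ => x ^ r) A

/-- The logarithm of a symmetric positive definite matrix (spectral calculus). -/
noncomputable def log {d : ℕ} (A : Matrix (Fin d) (Fin d) ℝ) : Matrix (Fin d) (Fin d) ℝ :=
  cfc Real.log A

/-- The Frobenius norm. -/
noncomputable def frobeniusNorm {d : ℕ} (A : Matrix (Fin d) (Fin d) ℝ) : ℝ :=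
  √(∑ i, ∑ j, A i j ^ 2)

/-- The S-divergence `δ_S²(X, Y)`. -/
noncomputable def sDivergence {d : ℕ} (X Y : Matrix (Fin d) (Fin d) ℝ) : ℝ :=
  Real.log ((1 / 2 : ℝ) • (X + Y)).det - (1 / 2) * Real.log (X * Y).det

/-- The affine-invariant Riemannian distance `‖log (Y^(-1/2) X Y^(-1/2))‖_F`. -/
noncomputable def dist {d : ℕ} (X Y : Matrix (Fin d) (Fin d) ℝ) : ℝ :=
  frobeniusNorm (log (rpow Y (-(1 / 2)) * X * rpow Y (-(1 / 2))))

/-- The values `yᵀ X y` at the unit vectors `y` of `ℝ^d`. -/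
def unitQuadraticValues {d : ℕ} (X : Matrix (Fin d) (Fin d) ℝ) : Set ℝ :=
  {r | ∃ y : EuclideanSpace ℝ (Fin d), ‖y‖ = 1 ∧ r = y.ofLp ⬝ᵥ X *ᵥ y.ofLp}

end SPD

/-! The acceleration of a geodesic is `γ' γ⁻¹ γ'`, so `γ⁻¹ γ'` is constant. Diagonalizing `γ 0` and
`γ' 0` simultaneously by a congruence `M` decouples this linear equation and shows that every
geodesic is `M diag(exp(t l)) Mᵀ` (`IsGeodesicSegment.exists_eq_expCurve`). Conversely these curves
are geodesics, and they join any two points. By `gConvexOn_manifold`, only convexity along them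
remains to be shown.

Along such a curve, traces and quadratic forms are sums of exponentials with nonnegative
coefficients, and `log det` is affine. For positive semidefinite `K`, `det (K + γ t)` is again such
a sum, with principal minors as coefficients, so its logarithm is convex (`convexOn_log_det_add`);
this gives the S-divergence. The squared distance is, up to a factor and a constant, an integral
over `v > 0` of `log det (1 + e⁻ᵛ Z) + log det (1 + e⁻ᵛ Z⁻¹)`, hence convex too
(`integral_log_det`). Inversion preserves the family of curves. -/

namespace SPD

/-! ### Convexity of exponential sums and of their logarithms -/

/-- A sum of exponentials with nonnegative coefficients is convex. -/
lemma convexOn_sum_exp {ι : Type*} (s : Finset ι) (c μ : ι → ℝ) (hc : ∀ i ∈ s, 0 ≤ c i) :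
    ConvexOn ℝ Set.univ (fun t : ℝ => ∑ i ∈ s, c i * Real.exp (t * μ i)) := by
  refine ⟨convex_univ, fun x _ y _ a b ha hb hab => ?_⟩
  simp only [smul_eq_mul, Finset.mul_sum, ← Finset.sum_add_distrib]
  refine Finset.sum_le_sum fun i hi => ?_
  have h := convexOn_exp.2 (Set.mem_univ (x * μ i)) (Set.mem_univ (y * μ i)) ha hb hab
  simp only [smul_eq_mul] at h
  calc c i * Real.exp ((a * x + b * y) * μ i)
      = c i * Real.exp (a * (x * μ i) + b * (y * μ i)) := by ring_nf
    _ ≤ c i * (a * Real.exp (x * μ i) + b * Real.exp (y * μ i)) :=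
        mul_le_mul_of_nonneg_left h (hc i hi)
    _ = _ := by ring

lemma sum_exp_pos {ι : Type*} {s : Finset ι} {c : ι → ℝ} (μ : ι → ℝ)
    (hc : ∀ i ∈ s, 0 ≤ c i) (hpos : ∃ i ∈ s, 0 < c i) (t : ℝ) :
    0 < ∑ i ∈ s, c i * Real.exp (t * μ i) := by
  obtain ⟨i, hi, hci⟩ := hpos
  exact Finset.sum_pos' (fun j hj => mul_nonneg (hc j hj) (Real.exp_pos _).le)
    ⟨i, hi, mul_pos hci (Real.exp_pos _)⟩

/-- The logarithm of a sum of exponentials with nonnegative coefficients is convex. -/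
lemma convexOn_log_sum_exp {ι : Type*} (s : Finset ι) (c μ : ι → ℝ) (hc : ∀ i ∈ s, 0 ≤ c i)
    (hpos : ∃ i ∈ s, 0 < c i) :
    ConvexOn ℝ Set.univ (fun t : ℝ => Real.log (∑ i ∈ s, c i * Real.exp (t * μ i))) := by
  refine ⟨convex_univ, fun x _ y _ a b ha hb hab => ?_⟩
  have hP := sum_exp_pos μ hc hpos x
  have hQ := sum_exp_pos μ hc hpos y
  have hR := sum_exp_pos μ hc hpos (a • x + b • y)
  set P := ∑ i ∈ s, c i * Real.exp (x * μ i) with hPdef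
  set Q := ∑ i ∈ s, c i * Real.exp (y * μ i) with hQdef
  simp only [smul_eq_mul] at hR ⊢
  have key : ∑ i ∈ s, c i * Real.exp ((a * x + b * y) * μ i) ≤
      Real.exp (a * Real.log P + b * Real.log Q) := by
    -- Hölder's inequality, proved termwise: after normalizing by `P` and `Q`, convexity of `exp`
    -- bounds each term, and the brackets sum to `a + b = 1`.
    have hterm : ∀ i ∈ s, c i * Real.exp ((a * x + b * y) * μ i) ≤
        Real.exp (a * Real.log P + b * Real.log Q) *
          (a * (c i * Real.exp (x * μ i) / P) + b * (c i * Real.exp (y * μ i) / Q)) := by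
      intro i hi
      have h := convexOn_exp.2 (Set.mem_univ (x * μ i - Real.log P))
        (Set.mem_univ (y * μ i - Real.log Q)) ha hb hab
      simp only [smul_eq_mul, Real.exp_sub, Real.exp_log hP, Real.exp_log hQ] at h
      calc c i * Real.exp ((a * x + b * y) * μ i)
          = Real.exp (a * Real.log P + b * Real.log Q) *
            (c i * Real.exp (a * (x * μ i - Real.log P) + b * (y * μ i - Real.log Q))) := by
            rw [mul_left_comm, ← Real.exp_add]; ring_nf
        _ ≤ Real.exp (a * Real.log P + b * Real.log Q) *
            (c i * (a * (Real.exp (x * μ i) / P) + b * (Real.exp (y * μ i) / Q))) := by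
            have := hc i hi
            gcongr
        _ = _ := by ring
    refine (Finset.sum_le_sum hterm).trans_eq ?_
    rw [← Finset.mul_sum, Finset.sum_add_distrib, ← Finset.mul_sum, ← Finset.mul_sum,
      ← Finset.sum_div, ← Finset.sum_div, ← hPdef, ← hQdef, div_self hP.ne', div_self hQ.ne',
      mul_one, mul_one, hab, mul_one]
  exact (Real.log_le_iff_le_exp hR).2 key

/-! ### Principal minor expansion of a determinant -/

section LinearAlgebra

variable {m : Type*} [Fintype m] [DecidableEq m]

/-- The matrix `A` with the rows indexed by `s` replaced by those of the identity matrix; its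
determinant is the principal minor of `A` on the complement of `s`. -/
def identityRows (s : Finset m) (A : Matrix m m ℝ) : Matrix m m ℝ :=
  Matrix.of fun i j => if i ∈ s then (1 : Matrix m m ℝ) i j else A i j

/-- The expansion of `det (diagonal x + A)` as a polynomial in `x`. -/
lemma det_diagonal_add (x : m → ℝ) (A : Matrix m m ℝ) :
    (Matrix.diagonal x + A).det = ∑ s : Finset m, (identityRows s A).det * ∏ i ∈ s, x i := by
  have h := (Matrix.detRowAlternating (n := m) (R := ℝ)).toMultilinearMap.map_add_univ
    (Matrix.diagonal x) A
  refine h.trans (Finset.sum_congr rfl fun s _ => ?_)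
  -- Row `i` of `diagonal x` is `x i` times a row of the identity, so multilinearity extracts the
  -- product over `s`.
  have hs : s.piecewise (Matrix.diagonal x) A =
      fun i => (if i ∈ s then x i else 1) • identityRows s A i := by
    ext i j
    by_cases hi : i ∈ s
    · refine (congrFun (Finset.piecewise_eq_of_mem s _ _ hi) j).trans ?_
      simp [identityRows, hi, Matrix.diagonal_apply, Matrix.one_apply]
    · refine (congrFun (Finset.piecewise_eq_of_notMem s _ _ hi) j).trans ?_
      simp [identityRows, hi]
  rw [hs]
  refine (MultilinearMap.map_smul_univ _ _ _).trans ?_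
  rw [Finset.prod_ite_mem, Finset.univ_inter, smul_eq_mul, mul_comm]
  rfl

/-- Principal minors of a positive semidefinite matrix are nonnegative. -/
lemma det_identityRows_nonneg {A : Matrix m m ℝ} (hA : A.PosSemidef) (s : Finset m) :
    0 ≤ (identityRows s A).det := by
  -- Block triangular: the block on `s` is the identity, the other is a principal submatrix of `A`.
  rw [Matrix.twoBlockTriangular_det' _ (fun i => i ∈ s)]
  · have h1 : Matrix.toSquareBlockProp (identityRows s A) (fun i => i ∈ s) = 1 := by
      ext ⟨i, hi⟩ ⟨j, hj⟩
      simp [Matrix.toSquareBlockProp, identityRows, hi, Matrix.one_apply]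
    have h2 : Matrix.toSquareBlockProp (identityRows s A) (fun i => ¬ i ∈ s) =
        A.submatrix (fun i => i.1) (fun i => i.1) := by
      ext ⟨i, hi⟩ ⟨j, hj⟩
      simp [Matrix.toSquareBlockProp, identityRows, hi]
    rw [h1, h2]
    refine mul_nonneg ?_ (hA.submatrix _).det_nonneg
    convert! zero_le_one (α := ℝ)
    convert! Matrix.det_one (R := ℝ) (n := {i // i ∈ s})
  · intro i hi j hj
    have : i ≠ j := fun h => hj (h ▸ hi)
    simp [identityRows, hi, this]

lemma identityRows_univ (A : Matrix m m ℝ) : identityRows Finset.univ A = 1 := by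
  ext i j
  simp [identityRows]

end LinearAlgebra

/-! ### Congruences and the curves `M diag(exp(t l)) Mᵀ` -/

variable {d : ℕ}

/-- The curve `t ↦ M diag(exp(t l)) Mᵀ`. -/
noncomputable def expCurve (M : Matrix (Fin d) (Fin d) ℝ) (l : Fin d → ℝ) (t : ℝ) :
    Matrix (Fin d) (Fin d) ℝ :=
  M * Matrix.diagonal (fun i => Real.exp (t * l i)) * Mᵀ

lemma posDef_conj {M K : Matrix (Fin d) (Fin d) ℝ} (hM : IsUnit M) (hK : K.PosDef) :
    (M * K * Mᵀ).PosDef := by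
  have := (Matrix.IsUnit.posDef_star_right_conjugate_iff (x := K) hM).2 hK
  simpa [Matrix.star_eq_conjTranspose] using this

lemma expCurve_posDef {M : Matrix (Fin d) (Fin d) ℝ} (hM : IsUnit M) (l : Fin d → ℝ) (t : ℝ) :
    (expCurve M l t).PosDef :=
  posDef_conj hM (Matrix.PosDef.diagonal fun _ => Real.exp_pos _)

lemma quadratic_conj_diagonal (M : Matrix (Fin d) (Fin d) ℝ) (e x : Fin d → ℝ) :
    x ⬝ᵥ (M * Matrix.diagonal e * Mᵀ) *ᵥ x = ∑ k, (Mᵀ *ᵥ x) k ^ 2 * e k := by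
  rw [← Matrix.mulVec_mulVec, ← Matrix.mulVec_mulVec, Matrix.dotProduct_mulVec,
    ← Matrix.mulVec_transpose]
  simp only [dotProduct, Matrix.mulVec_diagonal]
  exact Finset.sum_congr rfl fun k _ => by ring

lemma conj_diagonal_inv {M : Matrix (Fin d) (Fin d) ℝ} (e : Fin d → ℝ)
    (he : ∀ i, e i ≠ 0) :
    (M * Matrix.diagonal e * Mᵀ)⁻¹ = (M⁻¹)ᵀ * Matrix.diagonal (fun i => (e i)⁻¹) * (M⁻¹)ᵀᵀ := by
  have hd : (Matrix.diagonal e)⁻¹ = Matrix.diagonal (fun i => (e i)⁻¹) := by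
    refine Matrix.inv_eq_right_inv ?_
    rw [Matrix.diagonal_mul_diagonal]
    simp [he]
  rw [Matrix.mul_inv_rev, Matrix.mul_inv_rev, hd, Matrix.transpose_transpose,
    Matrix.transpose_nonsing_inv, Matrix.mul_assoc]

/-- Inversion only changes the parameters of the curve, so results for these curves transfer to
their inverses. -/
lemma expCurve_inv (M : Matrix (Fin d) (Fin d) ℝ) (l : Fin d → ℝ) (t : ℝ) :
    (expCurve M l t)⁻¹ = expCurve (M⁻¹)ᵀ (-l) t := by
  rw [expCurve, conj_diagonal_inv _ fun i => (Real.exp_pos _).ne']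
  simp [expCurve, Real.exp_neg]

lemma conj_expCurve (N M : Matrix (Fin d) (Fin d) ℝ) (l : Fin d → ℝ) (t : ℝ) :
    N * expCurve M l t * Nᵀ = expCurve (N * M) l t := by
  simp [expCurve, Matrix.mul_assoc, Matrix.transpose_mul]

/-- `log det (K + γ t)` is convex along the curves `expCurve M l`. -/
lemma convexOn_log_det_add {K M : Matrix (Fin d) (Fin d) ℝ} (hK : K.PosSemidef) (hM : IsUnit M)
    (l : Fin d → ℝ) :
    ConvexOn ℝ Set.univ (fun t : ℝ => Real.log (K + expCurve M l t).det) := by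
  have hMd : IsUnit M.det := (Matrix.isUnit_iff_isUnit_det _).1 hM
  set A := M⁻¹ * K * (M⁻¹)ᵀ with hA
  have hApsd : A.PosSemidef := by
    simpa using hK.mul_mul_conjTranspose_same M⁻¹
  have hMM : M * M⁻¹ = 1 := Matrix.mul_nonsing_inv _ hMd
  have hMM' : (M⁻¹)ᵀ * Mᵀ = 1 := by rw [← Matrix.transpose_mul, hMM, Matrix.transpose_one]
  have hKA : K = M * A * Mᵀ := by
    calc K = (M * M⁻¹) * K * ((M⁻¹)ᵀ * Mᵀ) := by rw [hMM, hMM', Matrix.one_mul, Matrix.mul_one]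
      _ = _ := by simp only [hA, Matrix.mul_assoc]
  -- Pulling `M` out of `K + γ t` leaves a diagonal matrix plus the positive semidefinite `A`, to
  -- which the minor expansion applies.
  have hdet : ∀ t, (K + expCurve M l t).det = ∑ s : Finset (Fin d),
      (M.det ^ 2 * (identityRows s A).det) *
        Real.exp (t * ∑ i ∈ s, l i) := by
    intro t
    have : K + expCurve M l t =
        M * (Matrix.diagonal (fun i => Real.exp (t * l i)) + A) * Mᵀ := by
      rw [Matrix.mul_add, Matrix.add_mul, ← hKA, add_comm, expCurve]
    rw [this, Matrix.det_mul, Matrix.det_mul, Matrix.det_transpose, det_diagonal_add,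
      Finset.mul_sum, Finset.sum_mul]
    refine Finset.sum_congr rfl fun s _ => ?_
    rw [Finset.mul_sum, Real.exp_sum]
    ring
  simp only [hdet]
  have hM2 : 0 < M.det ^ 2 := by have := hMd.ne_zero; positivity
  refine convexOn_log_sum_exp _ _ _
    (fun s _ => mul_nonneg hM2.le (det_identityRows_nonneg hApsd s))
    -- The full index set corresponds to the empty minor, equal to 1, so this coefficient is
    -- positive even when `K` is singular.
    ⟨Finset.univ, Finset.mem_univ _, mul_pos hM2 ?_⟩
  rw [identityRows_univ, Matrix.det_one]
  exact one_pos

lemma log_det_expCurve {M : Matrix (Fin d) (Fin d) ℝ} (hM : IsUnit M) (l : Fin d → ℝ) (t : ℝ) :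
    Real.log (expCurve M l t).det = Real.log (M.det ^ 2) + t * ∑ i, l i := by
  have hMd : M.det ≠ 0 := ((Matrix.isUnit_iff_isUnit_det _).1 hM).ne_zero
  rw [expCurve, Matrix.det_mul, Matrix.det_mul, Matrix.det_transpose, Matrix.det_diagonal,
    ← Real.exp_sum, ← Finset.mul_sum, mul_right_comm, ← pow_two,
    Real.log_mul (by positivity) (Real.exp_pos _).ne', Real.log_exp]

/-- Simultaneous diagonalization of a positive definite and a symmetric matrix by congruence. -/
lemma exists_simultaneous_diagonalization {A V : Matrix (Fin d) (Fin d) ℝ} (hA : A.PosDef)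
    (hV : V.IsSymm) :
    ∃ (M : Matrix (Fin d) (Fin d) ℝ) (μ : Fin d → ℝ), IsUnit M ∧ A = M * Mᵀ ∧
      V = M * Matrix.diagonal μ * Mᵀ := by
  obtain ⟨B, hB, hAB⟩ : ∃ B : Matrix (Fin d) (Fin d) ℝ, IsUnit B ∧ A = B * Bᵀ := by
    obtain ⟨y, hy, rfl⟩ := CStarAlgebra.isStrictlyPositive_iff_eq_star_mul_self.mp
      hA.isStrictlyPositive
    refine ⟨yᵀ, ?_, by simp [Matrix.star_eq_conjTranspose]⟩
    rwa [Matrix.isUnit_transpose]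
  have hBd : IsUnit B.det := (Matrix.isUnit_iff_isUnit_det _).1 hB
  have hBB : B * B⁻¹ = 1 := Matrix.mul_nonsing_inv _ hBd
  have hBB' : (B⁻¹)ᵀ * Bᵀ = 1 := by rw [← Matrix.transpose_mul, hBB, Matrix.transpose_one]
  -- The factor `B` reduces `A` to the identity, which the orthogonal diagonalization of `S`
  -- preserves; hence `M = B * U`.
  set S := B⁻¹ * V * (B⁻¹)ᵀ with hS
  have hSh : S.IsHermitian := by
    simp [Matrix.IsHermitian, hS, Matrix.transpose_mul, hV.eq, Matrix.mul_assoc]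
  set U : Matrix (Fin d) (Fin d) ℝ := hSh.eigenvectorUnitary.1 with hU
  have hUU : U * Uᵀ = 1 := by
    have := Unitary.coe_mul_star_self hSh.eigenvectorUnitary
    simpa [Matrix.star_eq_conjTranspose] using this
  have hspec : S = U * Matrix.diagonal hSh.eigenvalues * Uᵀ := by
    have := hSh.spectral_theorem
    rw [Unitary.conjStarAlgAut_apply] at this
    simpa [Matrix.star_eq_conjTranspose, Function.comp_def] using this
  refine ⟨B * U, hSh.eigenvalues, hB.mul (IsUnit.of_mul_eq_one _ hUU), ?_, ?_⟩
  · rw [Matrix.transpose_mul, Matrix.mul_assoc, ← Matrix.mul_assoc U, hUU, Matrix.one_mul, hAB]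
  · calc V = (B * B⁻¹) * V * ((B⁻¹)ᵀ * Bᵀ) := by rw [hBB, hBB', Matrix.one_mul, Matrix.mul_one]
      _ = B * S * Bᵀ := by simp only [hS, Matrix.mul_assoc]
      _ = B * (U * Matrix.diagonal hSh.eigenvalues * Uᵀ) * Bᵀ := by rw [← hspec]
      _ = _ := by simp only [Matrix.mul_assoc, Matrix.transpose_mul]

end SPD

namespace SPD

/-! ### The geodesic equation and its solutions -/

section Calculus

attribute [local instance] Matrix.linftyOpNormedRing Matrix.linftyOpNormedAlgebra

variable {d : ℕ}

/-- Passes from entrywise derivatives to derivatives in the normed algebra of matrices, where the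
product and inverse rules are available. -/
lemma hasDerivWithinAt_matrix {G : ℝ → Matrix (Fin d) (Fin d) ℝ} {G' : Matrix (Fin d) (Fin d) ℝ}
    {s : Set ℝ} {t : ℝ} (h : ∀ i j, HasDerivWithinAt (fun x => G x i j) (G' i j) s t) :
    HasDerivWithinAt G G' s t :=
  hasDerivWithinAt_pi.2 fun i => hasDerivWithinAt_pi.2 fun j => h i j

lemma hasDerivWithinAt_matrix_entry {G : ℝ → Matrix (Fin d) (Fin d) ℝ}
    {G' : Matrix (Fin d) (Fin d) ℝ} {s : Set ℝ} {t : ℝ} (h : HasDerivWithinAt G G' s t)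
    (i j : Fin d) : HasDerivWithinAt (fun x => G x i j) (G' i j) s t :=
  hasDerivWithinAt_pi.1 (hasDerivWithinAt_pi.1 h i) j

lemma hasDerivWithinAt_matrix_inv {G : ℝ → Matrix (Fin d) (Fin d) ℝ}
    {G' : Matrix (Fin d) (Fin d) ℝ} {s : Set ℝ} {t : ℝ} (h : HasDerivWithinAt G G' s t)
    (hu : IsUnit (G t)) :
    HasDerivWithinAt (fun x => (G x)⁻¹) (-((G t)⁻¹ * G' * (G t)⁻¹)) s t := by
  obtain ⟨u, hu⟩ := hu
  have h1 := hasFDerivAt_ringInverse (𝕜 := ℝ) u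
  rw [hu] at h1
  have h2 := h1.comp_hasDerivWithinAt t h
  have h3 : ((u⁻¹ : (Matrix (Fin d) (Fin d) ℝ)ˣ) : Matrix (Fin d) (Fin d) ℝ) = (G t)⁻¹ := by
    rw [← hu, Matrix.coe_units_inv]
  simp only [h3] at h2
  simpa [Function.comp_def, Matrix.nonsing_inv_eq_ringInverse] using! h2

lemma hasDerivAt_matrix_trace {G : ℝ → Matrix (Fin d) (Fin d) ℝ}
    {G' : Matrix (Fin d) (Fin d) ℝ} {t : ℝ} (h : HasDerivAt G G' t) :
    HasDerivAt (fun x => (G x).trace) G'.trace t :=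
  ((Matrix.traceLinearMap (Fin d) ℝ ℝ).toContinuousLinearMap.hasFDerivAt).comp_hasDerivAt t h

/-- The derivative of `X⁻¹` in direction `Z` is `-X⁻¹ Z X⁻¹`; the two terms come from the two
inverses in the metric. -/
lemma metricDeriv_eq {X : Matrix (Fin d) (Fin d) ℝ} (hX : IsUnit X)
    (Z U V : Matrix (Fin d) (Fin d) ℝ) :
    metricDeriv X Z U V =
      -(X⁻¹ * Z * X⁻¹ * U * X⁻¹ * V).trace - (X⁻¹ * U * X⁻¹ * Z * X⁻¹ * V).trace := by
  have h0 : HasDerivWithinAt (fun s : ℝ => X + s • Z) Z Set.univ 0 := by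
    have := ((hasDerivAt_id (0 : ℝ)).smul_const Z).const_add X
    rw [one_smul] at this
    exact this.hasDerivWithinAt
  have h1' := hasDerivWithinAt_matrix_inv h0 (by simpa using hX)
  rw [zero_smul, add_zero] at h1'
  have h1 := h1'.hasDerivAt Filter.univ_mem
  have h2 := hasDerivAt_matrix_trace (((h1.mul_const U).mul h1).mul_const V)
  rw [metricDeriv]
  refine h2.deriv.trans ?_
  simp [Matrix.add_mul, Matrix.mul_assoc, Matrix.trace_add]
  ring

/-- By cyclicity all the traces coincide; they occur with total coefficient `(1/2)(-2 - 2 + 2) =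
-1`. -/
lemma christoffel_self {X : Matrix (Fin d) (Fin d) ℝ} (hX : IsUnit X)
    (U W : Matrix (Fin d) (Fin d) ℝ) :
    christoffel X U U W = -(X⁻¹ * U * X⁻¹ * U * X⁻¹ * W).trace := by
  rw [christoffel, metricDeriv_eq hX, metricDeriv_eq hX]
  have h1 : (X⁻¹ * W * X⁻¹ * U * X⁻¹ * U).trace = (X⁻¹ * U * X⁻¹ * U * X⁻¹ * W).trace := by
    rw [show X⁻¹ * W * X⁻¹ * U * X⁻¹ * U = (X⁻¹ * W) * (X⁻¹ * U * X⁻¹ * U) by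
      simp only [Matrix.mul_assoc], Matrix.trace_mul_comm]
    simp only [Matrix.mul_assoc]
  have h2 : (X⁻¹ * U * X⁻¹ * W * X⁻¹ * U).trace = (X⁻¹ * U * X⁻¹ * U * X⁻¹ * W).trace := by
    rw [show X⁻¹ * U * X⁻¹ * W * X⁻¹ * U = (X⁻¹ * U * X⁻¹ * W) * (X⁻¹ * U) by
      simp only [Matrix.mul_assoc], Matrix.trace_mul_comm]
    simp only [Matrix.mul_assoc]
  rw [h1, h2]
  ring

/-- The geodesic equation in closed form: the acceleration is `U X⁻¹ U`. -/
lemma geodesic_equation_iff {X U A : Matrix (Fin d) (Fin d) ℝ} (hX : X.PosDef) (hU : U.IsSymm)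
    (hA : A.IsSymm) :
    (∀ W : Matrix (Fin d) (Fin d) ℝ, W.IsSymm → metric X A W + christoffel X U U W = 0) ↔
      A = U * X⁻¹ * U := by
  have hXs : X⁻¹ᵀ = X⁻¹ := by simpa using hX.inv.isHermitian.eq
  set R := X⁻¹ * (A - U * X⁻¹ * U) * X⁻¹ with hR
  have hRs : R.IsSymm := by
    simp [Matrix.IsSymm, hR, Matrix.transpose_mul, hXs, hA.eq, hU.eq, Matrix.mul_assoc]
  have hexp : ∀ W, metric X A W + christoffel X U U W = (R * W).trace := by
    intro W
    rw [christoffel_self hX.isUnit, metric, ← sub_eq_add_neg, ← Matrix.trace_sub, hR]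
    simp only [Matrix.mul_sub, Matrix.sub_mul, Matrix.mul_assoc]
  constructor
  · intro h
    -- `R` is itself an admissible test direction, which gives `tr (R Rᵀ) = 0`.
    have h1 := h R hRs
    rw [hexp] at h1
    have h2 : R = 0 := by
      refine Matrix.trace_mul_conjTranspose_self_eq_zero_iff.1 ?_
      simpa [hRs.eq] using h1
    have hXu : IsUnit X.det := (Matrix.isUnit_iff_isUnit_det _).1 hX.isUnit
    have h3 : X * R * X = A - U * X⁻¹ * U := by
      simp only [hR, ← Matrix.mul_assoc, Matrix.mul_nonsing_inv _ hXu, Matrix.one_mul]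
      rw [Matrix.mul_assoc, Matrix.nonsing_inv_mul _ hXu, Matrix.mul_one]
    rw [h2, Matrix.mul_zero, Matrix.zero_mul] at h3
    exact sub_eq_zero.1 h3.symm
  · rintro h W -
    rw [hexp, hR, h, sub_self, Matrix.mul_zero, Matrix.zero_mul, Matrix.zero_mul,
      Matrix.trace_zero]

lemma uniqueDiffWithinAt_unitInterval {t : ℝ} (ht : t ∈ Set.Icc (0 : ℝ) 1) :
    UniqueDiffWithinAt ℝ (Set.Icc (0 : ℝ) 1) t :=
  uniqueDiffOn_Icc one_pos t ht

lemma velocity_eq {γ : ℝ → Matrix (Fin d) (Fin d) ℝ} {V : Matrix (Fin d) (Fin d) ℝ} {t : ℝ}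
    (ht : t ∈ Set.Icc (0 : ℝ) 1) (h : HasDerivWithinAt γ V (Set.Icc 0 1) t) :
    velocity γ t = V := by
  ext i j
  exact (hasDerivWithinAt_matrix_entry h i j).derivWithin (uniqueDiffWithinAt_unitInterval ht)

lemma hasDerivWithinAt_velocity {γ : ℝ → Matrix (Fin d) (Fin d) ℝ} {t : ℝ}
    (h : ∀ i j, DifferentiableWithinAt ℝ (fun s => γ s i j) (Set.Icc 0 1) t) :
    HasDerivWithinAt γ (velocity γ t) (Set.Icc 0 1) t :=
  hasDerivWithinAt_matrix fun i j => (h i j).hasDerivWithinAt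

lemma velocity_isSymm {γ : ℝ → Matrix (Fin d) (Fin d) ℝ} {t : ℝ} (ht : t ∈ Set.Icc (0 : ℝ) 1)
    (h : ∀ s ∈ Set.Icc (0 : ℝ) 1, (γ s).IsSymm) : (velocity γ t).IsSymm := by
  ext i j
  exact derivWithin_congr (fun s hs => (h s hs).apply i j) ((h t ht).apply i j)

lemma IsGeodesicSegment.isSymm {γ : ℝ → Matrix (Fin d) (Fin d) ℝ} (hγ : IsGeodesicSegment γ)
    {t : ℝ} (ht : t ∈ Set.Icc (0 : ℝ) 1) : (γ t).IsSymm := by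
  simpa using! (hγ.mem_manifold t ht).isHermitian

lemma IsGeodesicSegment.hasDerivWithinAt {γ : ℝ → Matrix (Fin d) (Fin d) ℝ}
    (hγ : IsGeodesicSegment γ) {t : ℝ} (ht : t ∈ Set.Icc (0 : ℝ) 1) :
    HasDerivWithinAt γ (velocity γ t) (Set.Icc 0 1) t :=
  hasDerivWithinAt_velocity fun i j => (hγ.contDiffOn i j).differentiableOn (by norm_num) t ht

lemma IsGeodesicSegment.hasDerivWithinAt_velocity {γ : ℝ → Matrix (Fin d) (Fin d) ℝ}
    (hγ : IsGeodesicSegment γ) {t : ℝ} (ht : t ∈ Set.Icc (0 : ℝ) 1) :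
    HasDerivWithinAt (velocity γ) (velocity γ t * (γ t)⁻¹ * velocity γ t) (Set.Icc 0 1) t := by
  have h1 : HasDerivWithinAt (velocity γ) (velocity (velocity γ) t) (Set.Icc 0 1) t := by
    refine SPD.hasDerivWithinAt_velocity fun i j => ?_
    have := (hγ.contDiffOn i j).derivWithin (m := 1) (uniqueDiffOn_Icc one_pos) (by norm_num)
    exact this.differentiableOn (by norm_num) t ht
  have hsymm : ∀ s ∈ Set.Icc (0 : ℝ) 1, (velocity γ s).IsSymm := fun s hs =>
    velocity_isSymm hs fun _ => hγ.isSymm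
  rwa [(geodesic_equation_iff (hγ.mem_manifold t ht) (hsymm t ht)
    (velocity_isSymm ht hsymm)).1 (hγ.geodesic_equation t ht)] at h1

/-- Along a geodesic, `γ⁻¹ γ'` is constant. -/
lemma IsGeodesicSegment.inv_mul_velocity {γ : ℝ → Matrix (Fin d) (Fin d) ℝ}
    (hγ : IsGeodesicSegment γ) {t : ℝ} (ht : t ∈ Set.Icc (0 : ℝ) 1) :
    (γ t)⁻¹ * velocity γ t = (γ 0)⁻¹ * velocity γ 0 := by
  have hder : ∀ t ∈ Set.Icc (0 : ℝ) 1,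
      HasDerivWithinAt (fun s => (γ s)⁻¹ * velocity γ s) 0 (Set.Icc 0 1) t := by
    intro t ht
    have h := (hasDerivWithinAt_matrix_inv (hγ.hasDerivWithinAt ht)
      (hγ.mem_manifold t ht).isUnit).mul
      (hγ.hasDerivWithinAt_velocity ht)
    convert! h using 1
    -- `-γ⁻¹ γ' γ⁻¹ γ'` cancels against `γ⁻¹ (γ' γ⁻¹ γ')`.
    simp [Matrix.mul_assoc]
  exact constant_of_derivWithin_zero (fun t ht => (hder t ht).differentiableWithinAt)
    (fun t ht => (hder t (Set.Ico_subset_Icc_self ht)).derivWithin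
      (uniqueDiffWithinAt_unitInterval (Set.Ico_subset_Icc_self ht))) t ht

/-- Every geodesic segment has the form `M diag(exp(t l)) Mᵀ`. -/
lemma IsGeodesicSegment.exists_eq_expCurve {γ : ℝ → Matrix (Fin d) (Fin d) ℝ}
    (hγ : IsGeodesicSegment γ) :
    ∃ (M : Matrix (Fin d) (Fin d) ℝ) (l : Fin d → ℝ), IsUnit M ∧
      ∀ t ∈ Set.Icc (0 : ℝ) 1, γ t = expCurve M l t := by
  have h0 : (0 : ℝ) ∈ Set.Icc (0 : ℝ) 1 := by simp
  obtain ⟨M, l, hM, hA, hV⟩ := exists_simultaneous_diagonalization (hγ.mem_manifold 0 h0)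
    (velocity_isSymm h0 fun _ => hγ.isSymm)
  refine ⟨M, l, hM, fun t ht => ?_⟩
  have hMd : IsUnit M.det := (Matrix.isUnit_iff_isUnit_det _).1 hM
  have hMM : M⁻¹ * M = 1 := Matrix.nonsing_inv_mul _ hMd
  have hMM2 : M * M⁻¹ = 1 := Matrix.mul_nonsing_inv _ hMd
  have hTT : Mᵀ * (M⁻¹)ᵀ = 1 := by rw [← Matrix.transpose_mul, hMM, Matrix.transpose_one]
  have hTT2 : (M⁻¹)ᵀ * Mᵀ = 1 := by rw [← Matrix.transpose_mul, hMM2, Matrix.transpose_one]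
  have hC : (γ 0)⁻¹ * velocity γ 0 * (M⁻¹)ᵀ = (M⁻¹)ᵀ * Matrix.diagonal l := by
    rw [hV, hA, Matrix.mul_inv_rev, ← Matrix.transpose_nonsing_inv]
    calc (M⁻¹)ᵀ * M⁻¹ * (M * Matrix.diagonal l * Mᵀ) * (M⁻¹)ᵀ
        = (M⁻¹)ᵀ * (M⁻¹ * M) * Matrix.diagonal l * (Mᵀ * (M⁻¹)ᵀ) := by
          simp only [Matrix.mul_assoc]
      _ = _ := by rw [hMM, hTT, Matrix.mul_one, Matrix.mul_one]
  have hvel : ∀ s ∈ Set.Icc (0 : ℝ) 1,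
      M⁻¹ * velocity γ s * (M⁻¹)ᵀ = M⁻¹ * γ s * (M⁻¹)ᵀ * Matrix.diagonal l := by
    intro s hs
    have hu : IsUnit (γ s).det := (Matrix.isUnit_iff_isUnit_det _).1 (hγ.mem_manifold s hs).isUnit
    have : velocity γ s = γ s * ((γ 0)⁻¹ * velocity γ 0) := by
      rw [← hγ.inv_mul_velocity hs, ← Matrix.mul_assoc, Matrix.mul_nonsing_inv _ hu,
        Matrix.one_mul]
    rw [this, Matrix.mul_assoc, Matrix.mul_assoc, hC]
    simp only [Matrix.mul_assoc]
  -- `N = M⁻¹ γ M⁻ᵀ` solves `N' = N diag(l)` with `N 0 = 1`; each entry is integrated with the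
  -- factor `exp(-s l j)`.
  have hentry : M⁻¹ * γ t * (M⁻¹)ᵀ = Matrix.diagonal (fun i => Real.exp (t * l i)) := by
    ext i j
    have hd : ∀ s ∈ Set.Icc (0 : ℝ) 1, HasDerivWithinAt
        (fun s => (M⁻¹ * γ s * (M⁻¹)ᵀ) i j * Real.exp (-(s * l j))) 0 (Set.Icc 0 1) s := by
      intro s hs
      have h1 := hasDerivWithinAt_matrix_entry
        (((hγ.hasDerivWithinAt hs).const_mul M⁻¹).mul_const (M⁻¹)ᵀ) i j
      rw [hvel s hs, Matrix.mul_diagonal] at h1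
      have h2 : HasDerivAt (fun s => Real.exp (-(s * l j))) (Real.exp (-(s * l j)) * -(1 * l j)) s :=
        (((hasDerivAt_id s).mul_const (l j)).neg).exp
      convert! h1.mul h2.hasDerivWithinAt using 1
      ring
    have h := constant_of_derivWithin_zero (fun s hs => (hd s hs).differentiableWithinAt)
      (fun s hs => (hd s (Set.Ico_subset_Icc_self hs)).derivWithin
        (uniqueDiffWithinAt_unitInterval (Set.Ico_subset_Icc_self hs))) t ht
    have hz : M⁻¹ * γ 0 * (M⁻¹)ᵀ = 1 := by
      rw [hA, ← Matrix.mul_assoc, hMM, Matrix.one_mul, hTT]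
    simp only [hz, zero_mul, neg_zero, Real.exp_zero, mul_one] at h
    rw [Real.exp_neg, mul_inv_eq_iff_eq_mul₀ (Real.exp_pos _).ne'] at h
    rw [h, Matrix.one_apply, Matrix.diagonal_apply]
    split_ifs with hij
    · rw [hij, one_mul]
    · rw [zero_mul]
  calc γ t = (M * M⁻¹) * γ t * ((M⁻¹)ᵀ * Mᵀ) := by
        rw [hMM2, hTT2, Matrix.one_mul, Matrix.mul_one]
    _ = M * (M⁻¹ * γ t * (M⁻¹)ᵀ) * Mᵀ := by simp only [Matrix.mul_assoc]
    _ = _ := by rw [hentry, expCurve]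

lemma hasDerivAt_conj_diagonal (M : Matrix (Fin d) (Fin d) ℝ) (c l : Fin d → ℝ) (t : ℝ) :
    HasDerivAt (fun t => M * Matrix.diagonal (fun i => c i * Real.exp (t * l i)) * Mᵀ)
      (M * Matrix.diagonal (fun i => c i * l i * Real.exp (t * l i)) * Mᵀ) t := by
  have h : HasDerivAt (fun t => Matrix.diagonal (fun i => c i * Real.exp (t * l i)))
      (Matrix.diagonal (fun i => c i * l i * Real.exp (t * l i))) t := by
    refine hasDerivAt_pi.2 fun i => hasDerivAt_pi.2 fun j => ?_
    by_cases hij : i = j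
    · subst hij
      have h2 : HasDerivAt (fun s => Real.exp (s * l i)) (Real.exp (t * l i) * (1 * l i)) t :=
        ((hasDerivAt_id t).mul_const (l i)).exp
      simp only [Matrix.diagonal_apply_eq]
      convert! h2.const_mul (c i) using 1
      ring
    · simpa only [Matrix.diagonal_apply_ne _ hij] using hasDerivAt_const t (0 : ℝ)
  exact (h.const_mul M).mul_const Mᵀ

/-- The factors `M` cancel in `γ' γ⁻¹ γ'`, leaving on the diagonal `l eᵗˡ · e⁻ᵗˡ · l eᵗˡ = l² eᵗˡ`,
which is the acceleration. -/
lemma isGeodesicSegment_expCurve {M : Matrix (Fin d) (Fin d) ℝ} (hM : IsUnit M)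
    (l : Fin d → ℝ) : IsGeodesicSegment (expCurve M l) := by
  have hMd : IsUnit M.det := (Matrix.isUnit_iff_isUnit_det _).1 hM
  have hMM : M⁻¹ * M = 1 := Matrix.nonsing_inv_mul _ hMd
  have hTT : Mᵀ * (M⁻¹)ᵀ = 1 := by rw [← Matrix.transpose_mul, hMM, Matrix.transpose_one]
  have hv : ∀ t ∈ Set.Icc (0 : ℝ) 1, velocity (expCurve M l) t =
      M * Matrix.diagonal (fun i => l i * Real.exp (t * l i)) * Mᵀ := by
    intro t ht
    refine velocity_eq ht ?_
    have := hasDerivAt_conj_diagonal M 1 l t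
    simpa [expCurve] using! this.hasDerivWithinAt
  have ha : ∀ t ∈ Set.Icc (0 : ℝ) 1, velocity (velocity (expCurve M l)) t =
      M * Matrix.diagonal (fun i => l i * l i * Real.exp (t * l i)) * Mᵀ := by
    intro t ht
    refine velocity_eq ht ?_
    exact (hasDerivAt_conj_diagonal M l l t).hasDerivWithinAt.congr hv (hv t ht)
  have hsymm : ∀ e : Fin d → ℝ, (M * Matrix.diagonal e * Mᵀ).IsSymm := by
    intro e
    simp [Matrix.IsSymm, Matrix.transpose_mul, Matrix.mul_assoc]
  refine ⟨fun t _ => expCurve_posDef hM l t, fun i j => ?_, fun t ht => ?_⟩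
  · have : (fun t => expCurve M l t i j) =
        fun t => ∑ k, M i k * Real.exp (t * l k) * M j k := by
      funext t
      rw [expCurve, Matrix.mul_apply]
      simp only [Matrix.mul_diagonal, Matrix.transpose_apply]
    rw [this]
    fun_prop
  · rw [geodesic_equation_iff (expCurve_posDef hM l t) (by rw [hv t ht]; exact hsymm _)
      (by rw [ha t ht]; exact hsymm _), ha t ht, hv t ht, expCurve_inv, expCurve,
      Matrix.transpose_transpose]
    set D := Matrix.diagonal fun i => l i * Real.exp (t * l i)
    set E := Matrix.diagonal fun i => Real.exp (t * (-l) i)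
    have hDED : D * E * D = Matrix.diagonal (fun i => l i * l i * Real.exp (t * l i)) := by
      simp only [D, E, Matrix.diagonal_mul_diagonal]
      congr 1
      funext i
      have : Real.exp (t * l i) * Real.exp (t * (-l) i) = 1 := by
        rw [← Real.exp_add]; simp
      linear_combination (l i * l i * Real.exp (t * l i)) * this
    rw [← hDED]
    calc M * (D * E * D) * Mᵀ = M * D * (1 : Matrix (Fin d) (Fin d) ℝ) * E * 1 * D * Mᵀ := by
          simp only [Matrix.mul_assoc, Matrix.mul_one]
      _ = M * D * (Mᵀ * (M⁻¹)ᵀ) * E * (M⁻¹ * M) * D * Mᵀ := by rw [hTT, hMM]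
      _ = _ := by simp only [Matrix.mul_assoc]

lemma isGConvexSet_manifold : IsGConvexSet (manifold d) := by
  refine ⟨subset_rfl, fun A hA B hB => ?_⟩
  obtain ⟨M, μ, hM, hAM, hBM⟩ := exists_simultaneous_diagonalization hA
    (V := B) (by simpa using! hB.isHermitian)
  have hμ : ∀ i, 0 < μ i := by
    rw [← Matrix.posDef_diagonal_iff, ← Matrix.IsUnit.posDef_star_right_conjugate_iff hM]
    simpa [Matrix.star_eq_conjTranspose, hBM] using! hB
  -- With `A = M Mᵀ` and `B = M diag(μ) Mᵀ`, the exponents `log μ` make the curve end at `B`.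
  have hg := isGeodesicSegment_expCurve hM (fun i => Real.log (μ i))
  refine ⟨_, hg, ?_, ?_, hg.mem_manifold⟩
  · simp [expCurve, hAM]
  · simp [expCurve, hBM, Real.exp_log (hμ _)]

end Calculus

/-- A function is geodesically convex on the whole manifold as soon as it is convex along the
curves `M diag(exp(t l)) Mᵀ`. -/
lemma gConvexOn_manifold {d : ℕ} {β : Type*} [AddCommMonoid β] [PartialOrder β] [SMul ℝ β]
    {f : Matrix (Fin d) (Fin d) ℝ → β}
    (h : ∀ (M : Matrix (Fin d) (Fin d) ℝ) (l : Fin d → ℝ), IsUnit M →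
      ConvexOn ℝ Set.univ fun t => f (expCurve M l t)) :
    GConvexOn (manifold d) f := by
  refine ⟨isGConvexSet_manifold, fun γ hγ _ _ => ?_⟩
  obtain ⟨M, l, hM, heq⟩ := hγ.exists_eq_expCurve
  have hc := (h M l hM).subset (Set.subset_univ _) (convex_Icc (0 : ℝ) 1)
  exact hc.congr fun t ht => by simp only [heq t ht]

end SPD

namespace SPD

/-! ### The square as an integral of softplus functions -/

section Softplus

open MeasureTheory

/-- The function `u ↦ log (1 + exp u)`. -/
noncomputable def softplus (u : ℝ) : ℝ := Real.log (1 + Real.exp u)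

lemma softplus_nonneg (u : ℝ) : 0 ≤ softplus u :=
  Real.log_nonneg (by linarith [Real.exp_pos u])

lemma softplus_le_exp (u : ℝ) : softplus u ≤ Real.exp u := by
  have := Real.log_le_sub_one_of_pos (show 0 < 1 + Real.exp u by positivity)
  rw [softplus]
  linarith

lemma continuous_softplus : Continuous softplus := by
  refine Continuous.log (by fun_prop) fun u => ?_
  positivity

lemma softplus_sub_softplus_neg (u : ℝ) : softplus u - softplus (-u) = u := by
  have h : 1 + Real.exp u = Real.exp u * (1 + Real.exp (-u)) := by
    rw [mul_add, ← Real.exp_add]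
    simp [add_comm]
  rw [softplus, h, Real.log_mul (Real.exp_pos u).ne' (by positivity), Real.log_exp, softplus]
  ring

lemma integrableOn_softplus_Iic (a : ℝ) : IntegrableOn softplus (Set.Iic a) := by
  refine (integrableOn_exp_Iic a).mono' continuous_softplus.aestronglyMeasurable.restrict
    (Filter.Eventually.of_forall fun x => ?_)
  rw [Real.norm_of_nonneg (softplus_nonneg x)]
  exact softplus_le_exp x

lemma integrableOn_softplus_sub (u : ℝ) :
    IntegrableOn (fun v => softplus (u - v)) (Set.Ioi 0) := by
  refine ((integrableOn_exp_neg_Ioi 0).const_mul (Real.exp u)).mono'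
    (continuous_softplus.comp (by fun_prop)).aestronglyMeasurable.restrict
    (Filter.Eventually.of_forall fun v => ?_)
  rw [Real.norm_of_nonneg (softplus_nonneg _), ← Real.exp_add]
  exact softplus_le_exp _

lemma integral_softplus_sub (u : ℝ) :
    ∫ v in Set.Ioi (0 : ℝ), softplus (u - v) = ∫ w in Set.Iic u, softplus w := by
  have h1 := integral_comp_neg_Ioi (0 : ℝ) (fun x => softplus (u + x))
  simp only [← sub_eq_add_neg, neg_zero] at h1
  rw [h1]
  have h2 := (measurePreserving_add_left volume u).setIntegral_preimage_emb
    (measurableEmbedding_addLeft u) softplus (Set.Iic u)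
  simpa using h2

/-- Relative to `u = 0`, the two tail integrals change in total by the integral of `softplus x -
softplus (-x) = x` from `0` to `u`, which is `u² / 2`. -/
lemma integral_softplus_add (u : ℝ) :
    ∫ v in Set.Ioi (0 : ℝ), (softplus (u - v) + softplus (-u - v)) =
      u ^ 2 / 2 + 2 * ∫ w in Set.Iic (0 : ℝ), softplus w := by
  rw [integral_add (integrableOn_softplus_sub u) (integrableOn_softplus_sub (-u)),
    integral_softplus_sub, integral_softplus_sub]
  have h1 := intervalIntegral.integral_Iic_sub_Iic (integrableOn_softplus_Iic 0)
    (integrableOn_softplus_Iic u)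
  have h2 := intervalIntegral.integral_Iic_sub_Iic (integrableOn_softplus_Iic 0)
    (integrableOn_softplus_Iic (-u))
  have h3 : ∫ x in (0 : ℝ)..u, softplus (-x) = ∫ x in (-u)..0, softplus x := by
    rw [intervalIntegral.integral_comp_neg]; simp
  have h4 : ∫ x in (0 : ℝ)..u, softplus x - softplus (-x) = u ^ 2 / 2 := by
    simp only [softplus_sub_softplus_neg, integral_id]
    ring
  have h5 : Continuous fun x => softplus (-x) := continuous_softplus.comp continuous_neg
  rw [intervalIntegral.integral_sub (continuous_softplus.intervalIntegrable _ _)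
    (h5.intervalIntegrable _ _), h3] at h4
  rw [intervalIntegral.integral_symm] at h2
  linarith

end Softplus

/-! ### Spectral calculus and the squared distance -/

variable {d : ℕ}

/-- The spectral calculus of a symmetric matrix in terms of an orthogonal diagonalization. -/
lemma exists_cfc_eq {A : Matrix (Fin d) (Fin d) ℝ} (hA : A.IsHermitian) :
    ∃ U : Matrix (Fin d) (Fin d) ℝ, U * Uᵀ = 1 ∧
      A = U * Matrix.diagonal hA.eigenvalues * Uᵀ ∧
      ∀ f : ℝ → ℝ, cfc f A = U * Matrix.diagonal (fun i => f (hA.eigenvalues i)) * Uᵀ := by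
  refine ⟨hA.eigenvectorUnitary.1, ?_, ?_, fun f => ?_⟩
  · have := Unitary.coe_mul_star_self hA.eigenvectorUnitary
    simpa [Matrix.star_eq_conjTranspose] using this
  · have := hA.spectral_theorem
    rw [Unitary.conjStarAlgAut_apply] at this
    simpa [Matrix.star_eq_conjTranspose, Function.comp_def] using this
  · rw [hA.cfc_eq, Matrix.IsHermitian.cfc, Unitary.conjStarAlgAut_apply]
    simp [Matrix.star_eq_conjTranspose, Function.comp_def]

lemma rpow_isSymm {Y : Matrix (Fin d) (Fin d) ℝ} (hY : Y.PosDef) (r : ℝ) :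
    (rpow Y r)ᵀ = rpow Y r := by
  obtain ⟨U, -, -, hf⟩ := exists_cfc_eq hY.isHermitian
  rw [rpow, hf]
  simp [Matrix.transpose_mul, Matrix.mul_assoc]

lemma rpow_isUnit {Y : Matrix (Fin d) (Fin d) ℝ} (hY : Y.PosDef) (r : ℝ) : IsUnit (rpow Y r) := by
  obtain ⟨U, hU, -, hf⟩ := exists_cfc_eq hY.isHermitian
  have hUu : IsUnit U := IsUnit.of_mul_eq_one _ hU
  rw [rpow, hf]
  refine (posDef_conj hUu (Matrix.PosDef.diagonal fun i => ?_)).isUnit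
  exact Real.rpow_pos_of_pos (hY.eigenvalues_pos i) _

lemma frobeniusNorm_sq (A : Matrix (Fin d) (Fin d) ℝ) :
    frobeniusNorm A ^ 2 = (A * Aᵀ).trace := by
  rw [frobeniusNorm, Real.sq_sqrt (by positivity)]
  simp [Matrix.trace, Matrix.mul_apply, pow_two]

/-- `U` also diagonalizes the identity, so the determinant factors over the logarithms `u i` of the
eigenvalues. -/
lemma log_det_one_add_smul_conj {U : Matrix (Fin d) (Fin d) ℝ} (hU : U * Uᵀ = 1) (u : Fin d → ℝ)
    (v : ℝ) :
    Real.log (1 + Real.exp (-v) • (U * Matrix.diagonal (fun i => Real.exp (u i)) * Uᵀ)).det =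
      ∑ i, softplus (u i - v) := by
  have h : 1 + Real.exp (-v) • (U * Matrix.diagonal (fun i => Real.exp (u i)) * Uᵀ) =
      U * Matrix.diagonal (fun i => 1 + Real.exp (u i - v)) * Uᵀ := by
    have h2 : Matrix.diagonal (fun i => 1 + Real.exp (u i - v)) =
        1 + Real.exp (-v) • Matrix.diagonal (fun i => Real.exp (u i)) := by
      rw [← Matrix.diagonal_one, ← Matrix.diagonal_smul, Matrix.diagonal_add]
      congr 1
      funext i
      simp [sub_eq_neg_add, Real.exp_add]
    rw [h2, Matrix.mul_add, Matrix.add_mul, Matrix.mul_one, hU, Matrix.mul_smul, Matrix.smul_mul]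
  have hdet : U.det * U.det = 1 := by
    have := congrArg Matrix.det hU
    rwa [Matrix.det_mul, Matrix.det_transpose, Matrix.det_one] at this
  rw [h, Matrix.det_mul, Matrix.det_mul, Matrix.det_transpose, mul_right_comm, hdet, one_mul,
    Matrix.det_diagonal, Real.log_prod fun i _ => by positivity]
  rfl

/-- The squared Frobenius norm of the logarithm as an integral of log-determinants. -/
lemma integral_log_det {Z : Matrix (Fin d) (Fin d) ℝ} (hZ : Z.PosDef) :
    MeasureTheory.IntegrableOn (fun v : ℝ => Real.log (1 + Real.exp (-v) • Z).det +
      Real.log (1 + Real.exp (-v) • Z⁻¹).det) (Set.Ioi 0) ∧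
    ∫ v in Set.Ioi (0 : ℝ), (Real.log (1 + Real.exp (-v) • Z).det +
      Real.log (1 + Real.exp (-v) • Z⁻¹).det) =
      frobeniusNorm (log Z) ^ 2 / 2 + d * (2 * ∫ w in Set.Iic (0 : ℝ), softplus w) := by
  obtain ⟨U, hU, hZU, hf⟩ := exists_cfc_eq hZ.isHermitian
  set u : Fin d → ℝ := fun i => Real.log (hZ.isHermitian.eigenvalues i) with hu
  have hU' : Uᵀ * U = 1 := mul_eq_one_comm.1 hU
  have hexp : hZ.isHermitian.eigenvalues = fun i => Real.exp (u i) := by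
    funext i
    exact (Real.exp_log (hZ.eigenvalues_pos i)).symm
  rw [hexp] at hZU
  have hinv : Z⁻¹ = U * Matrix.diagonal (fun i => Real.exp ((-u) i)) * Uᵀ := by
    rw [hZU, conj_diagonal_inv _ fun i => (Real.exp_pos _).ne', Matrix.inv_eq_right_inv hU]
    simp [Real.exp_neg]
  have hlog : frobeniusNorm (log Z) ^ 2 = ∑ i, u i ^ 2 := by
    rw [frobeniusNorm_sq, log, hf]
    have : U * Matrix.diagonal u * Uᵀ * (U * Matrix.diagonal u * Uᵀ)ᵀ =
        U * (Matrix.diagonal u * (Uᵀ * U) * Matrix.diagonal u * Uᵀ) := by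
      simp [Matrix.transpose_mul, Matrix.mul_assoc]
    rw [this, Matrix.trace_mul_comm, Matrix.mul_assoc _ Uᵀ U, hU', Matrix.mul_one, Matrix.mul_one,
      Matrix.diagonal_mul_diagonal, Matrix.trace_diagonal]
    simp [pow_two]
  have hfun : ∀ v : ℝ, Real.log (1 + Real.exp (-v) • Z).det +
      Real.log (1 + Real.exp (-v) • Z⁻¹).det =
      ∑ i, (softplus (u i - v) + softplus (-u i - v)) := by
    intro v
    rw [hinv, log_det_one_add_smul_conj hU, hZU, log_det_one_add_smul_conj hU,
      ← Finset.sum_add_distrib]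
    rfl
  have hint : ∀ i, MeasureTheory.IntegrableOn
      (fun v => softplus (u i - v) + softplus (-u i - v)) (Set.Ioi 0) :=
    fun i => (integrableOn_softplus_sub _).add (integrableOn_softplus_sub _)
  simp only [hfun]
  refine ⟨MeasureTheory.integrable_finsetSum _ fun i _ => hint i, ?_⟩
  rw [MeasureTheory.integral_finsetSum _ fun i _ => hint i]
  simp only [integral_softplus_add, Finset.sum_add_distrib, hlog, ← Finset.sum_div]
  simp

/-- The scalar is split into two square roots, one for each factor `M`. -/
lemma smul_expCurve (M : Matrix (Fin d) (Fin d) ℝ) (l : Fin d → ℝ) (v t : ℝ) :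
    Real.exp (-v) • expCurve M l t = expCurve (Real.exp (-v / 2) • M) l t := by
  have : Real.exp (-v) = Real.exp (-v / 2) * Real.exp (-v / 2) := by
    rw [← Real.exp_add]; ring_nf
  rw [this]
  simp [expCurve, mul_smul]

lemma convexOn_log_det_one_add_smul {M : Matrix (Fin d) (Fin d) ℝ} (hM : IsUnit M)
    (l : Fin d → ℝ) (v : ℝ) :
    ConvexOn ℝ Set.univ fun t : ℝ => Real.log (1 + Real.exp (-v) • expCurve M l t).det := by
  simp only [smul_expCurve]
  refine convexOn_log_det_add Matrix.PosSemidef.one ?_ l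
  have : IsUnit (Real.exp (-v / 2)) := (Real.exp_pos _).ne'.isUnit
  simpa using! hM.smul this.unit

/-- An integral of convex functions is convex; the additive constant `c` drops out because `a + b =
1`. -/
lemma convexOn_frobeniusNorm_log_sq {M : Matrix (Fin d) (Fin d) ℝ} (hM : IsUnit M)
    (l : Fin d → ℝ) :
    ConvexOn ℝ Set.univ fun t : ℝ => frobeniusNorm (log (expCurve M l t)) ^ 2 := by
  have hM' : IsUnit (M⁻¹)ᵀ := by
    rw [Matrix.isUnit_transpose, Matrix.isUnit_nonsing_inv_iff]; exact hM
  set c : ℝ := d * (2 * ∫ w in Set.Iic (0 : ℝ), softplus w)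
  set Φ : ℝ → ℝ → ℝ := fun t v => Real.log (1 + Real.exp (-v) • expCurve M l t).det +
      Real.log (1 + Real.exp (-v) • (expCurve M l t)⁻¹).det with hΦ
  have hint : ∀ t, MeasureTheory.IntegrableOn (Φ t) (Set.Ioi 0) := fun t =>
    (integral_log_det (expCurve_posDef hM l t)).1
  have hval : ∀ t, ∫ v in Set.Ioi (0 : ℝ), Φ t v =
      frobeniusNorm (log (expCurve M l t)) ^ 2 / 2 + c := fun t =>
    (integral_log_det (expCurve_posDef hM l t)).2
  have hconv : ∀ v, ConvexOn ℝ Set.univ fun t => Φ t v := by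
    intro v
    simp only [hΦ, expCurve_inv]
    exact (convexOn_log_det_one_add_smul hM l v).add (convexOn_log_det_one_add_smul hM' (-l) v)
  refine ⟨convex_univ, fun x _ y _ a b ha hb hab => ?_⟩
  have h := MeasureTheory.setIntegral_mono (μ := MeasureTheory.volume) (s := Set.Ioi 0)
    (hint (a • x + b • y)) (((hint x).const_mul a).add ((hint y).const_mul b))
    fun v => (hconv v).2 (Set.mem_univ x) (Set.mem_univ y) ha hb hab
  simp only [Pi.add_apply] at h
  rw [MeasureTheory.integral_add ((hint x).const_mul a) ((hint y).const_mul b),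
    MeasureTheory.integral_const_mul, MeasureTheory.integral_const_mul, hval, hval, hval] at h
  simp only [smul_eq_mul] at h ⊢
  have hc : a * c + b * c = c := by rw [← add_mul, hab, one_mul]
  linarith

/-- The symmetric invertible factor `Y^(-1/2)` is absorbed into `M`. -/
lemma convexOn_dist_sq {M Y : Matrix (Fin d) (Fin d) ℝ} (hM : IsUnit M) (l : Fin d → ℝ)
    (hY : Y.PosDef) : ConvexOn ℝ Set.univ fun t : ℝ => dist (expCurve M l t) Y ^ 2 := by
  have h := convexOn_frobeniusNorm_log_sq ((rpow_isUnit hY (-(1 / 2))).mul hM) l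
  simp only [← conj_expCurve, rpow_isSymm hY] at h
  exact h

/-! ### The remaining functions along the curves -/

lemma convexOn_affine (a b : ℝ) : ConvexOn ℝ Set.univ fun t : ℝ => a + t * b :=
  ⟨convex_univ, fun x _ y _ p q _ _ hpq => le_of_eq <| by
    simp only [smul_eq_mul]
    linear_combination (-a) * hpq⟩

lemma convexOn_log_det (M : Matrix (Fin d) (Fin d) ℝ) (hM : IsUnit M) (l : Fin d → ℝ) :
    ConvexOn ℝ Set.univ fun t : ℝ => Real.log (expCurve M l t).det := by
  simp only [log_det_expCurve hM]
  exact convexOn_affine _ _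

lemma convexOn_sDivergence {M Y : Matrix (Fin d) (Fin d) ℝ} (hM : IsUnit M) (l : Fin d → ℝ)
    (hY : Y.PosDef) : ConvexOn ℝ Set.univ fun t : ℝ => sDivergence (expCurve M l t) Y := by
  -- Apart from `log det (Y + γ t)`, every contribution is affine in `t`.
  have h : ∀ t, sDivergence (expCurve M l t) Y = Real.log (Y + expCurve M l t).det +
      (Real.log ((1 / 2) ^ d) - (1 / 2) * (Real.log (M.det ^ 2) + Real.log Y.det) +
        t * (-(1 / 2) * ∑ i, l i)) := by
    intro t
    have h1 := (expCurve_posDef hM l t).det_pos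
    have h2 := (hY.add (expCurve_posDef hM l t)).det_pos
    rw [sDivergence, Matrix.det_smul, Matrix.det_mul, Real.log_mul h1.ne' hY.det_pos.ne',
      log_det_expCurve hM, Fintype.card_fin, add_comm (expCurve M l t) Y,
      Real.log_mul (by positivity) h2.ne']
    ring
  simp only [h]
  exact (convexOn_log_det_add hY.posSemidef hM l).add (convexOn_affine _ _)

lemma quadratic_expCurve (M : Matrix (Fin d) (Fin d) ℝ) (l x : Fin d → ℝ) (t : ℝ) :
    x ⬝ᵥ expCurve M l t *ᵥ x = ∑ k, (Mᵀ *ᵥ x) k ^ 2 * Real.exp (t * l k) :=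
  quadratic_conj_diagonal _ _ _

lemma convexOn_quadratic (M : Matrix (Fin d) (Fin d) ℝ) (l x : Fin d → ℝ) :
    ConvexOn ℝ Set.univ fun t : ℝ => x ⬝ᵥ expCurve M l t *ᵥ x := by
  simp only [quadratic_expCurve]
  exact convexOn_sum_exp _ _ _ fun _ _ => sq_nonneg _

lemma convexOn_log_sum_quadratic {n : ℕ} {M : Matrix (Fin d) (Fin d) ℝ} (hM : IsUnit M)
    (l : Fin d → ℝ) {x : Fin n → Fin d → ℝ} (hx : ∃ i, x i ≠ 0) :
    ConvexOn ℝ Set.univ fun t : ℝ => Real.log (∑ i, x i ⬝ᵥ expCurve M l t *ᵥ x i) := by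
  have h : ∀ t, ∑ i, x i ⬝ᵥ expCurve M l t *ᵥ x i =
      ∑ k, (∑ i, (Mᵀ *ᵥ x i) k ^ 2) * Real.exp (t * l k) := by
    intro t
    simp only [quadratic_expCurve, Finset.sum_mul]
    exact Finset.sum_comm
  simp only [h]
  refine convexOn_log_sum_exp _ _ _ (fun k _ => Finset.sum_nonneg fun i _ => sq_nonneg _) ?_
  obtain ⟨i, hi⟩ := hx
  -- Invertibility of `M` keeps a nonzero vector nonzero, which yields a positive coefficient.
  have hne : Mᵀ *ᵥ x i ≠ 0 := fun h0 => hi <|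
    Matrix.mulVec_injective_of_isUnit ((Matrix.isUnit_transpose M).2 hM) (by simpa using h0)
  obtain ⟨k, hk⟩ := Function.ne_iff.1 hne
  refine ⟨k, Finset.mem_univ _, Finset.sum_pos' (fun j _ => sq_nonneg _) ⟨i, Finset.mem_univ _, ?_⟩⟩
  exact sq_pos_of_ne_zero hk

lemma convexOn_trace (M : Matrix (Fin d) (Fin d) ℝ) (l : Fin d → ℝ) :
    ConvexOn ℝ Set.univ fun t : ℝ => (expCurve M l t).trace := by
  have h : ∀ t, (expCurve M l t).trace = ∑ k, (∑ i, M i k ^ 2) * Real.exp (t * l k) := by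
    intro t
    simp only [Matrix.trace, Matrix.diag, Finset.sum_mul]
    rw [Finset.sum_comm]
    refine Finset.sum_congr rfl fun i _ => ?_
    rw [expCurve, Matrix.mul_apply]
    simp only [Matrix.mul_diagonal, Matrix.transpose_apply]
    exact Finset.sum_congr rfl fun k _ => by ring
  simp only [h]
  exact convexOn_sum_exp _ _ _ fun _ _ => Finset.sum_nonneg fun _ _ => sq_nonneg _

/-- The Löwner gap is the congruence by `M` of a diagonal matrix whose entries are the scalar
convexity gaps of `exp`. -/
lemma convexOn_expCurve (M : Matrix (Fin d) (Fin d) ℝ) (l : Fin d → ℝ) :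
    ConvexOn ℝ Set.univ fun t : ℝ => expCurve M l t := by
  refine ⟨convex_univ, fun x _ y _ a b ha hb hab => ?_⟩
  rw [Matrix.le_iff]
  have h : a • expCurve M l x + b • expCurve M l y - expCurve M l (a • x + b • y) =
      M * Matrix.diagonal (fun i => a * Real.exp (x * l i) + b * Real.exp (y * l i) -
        Real.exp ((a * x + b * y) * l i)) * Mᵀ := by
    have h1 : Matrix.diagonal (fun i => a * Real.exp (x * l i) + b * Real.exp (y * l i) -
        Real.exp ((a * x + b * y) * l i)) = a • Matrix.diagonal (fun i => Real.exp (x * l i)) +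
          b • Matrix.diagonal (fun i => Real.exp (y * l i)) -
          Matrix.diagonal (fun i => Real.exp ((a * x + b * y) * l i)) := by
      simp only [← Matrix.diagonal_smul, Matrix.diagonal_add, Matrix.diagonal_sub, Pi.smul_def,
        smul_eq_mul]
    rw [h1]
    simp [expCurve, Matrix.mul_add, Matrix.add_mul, Matrix.mul_sub, Matrix.sub_mul]
  have hD : (Matrix.diagonal (fun i => a * Real.exp (x * l i) + b * Real.exp (y * l i) -
        Real.exp ((a * x + b * y) * l i))).PosSemidef := by
    refine Matrix.PosSemidef.diagonal fun i => ?_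
    have := convexOn_exp.2 (Set.mem_univ (x * l i)) (Set.mem_univ (y * l i)) ha hb hab
    simp only [smul_eq_mul] at this
    rw [show a * (x * l i) + b * (y * l i) = (a * x + b * y) * l i by ring] at this
    simpa using this
  rw [h]
  simpa using hD.mul_mul_conjTranspose_same M

/-- Needs `1 ≤ d`: in dimension zero there is no unit vector. -/
lemma unitQuadraticValues_nonempty (hd : 1 ≤ d) (X : Matrix (Fin d) (Fin d) ℝ) :
    (unitQuadraticValues X).Nonempty :=
  ⟨_, EuclideanSpace.single ⟨0, hd⟩ 1, by simp, rfl⟩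

lemma unitQuadraticValues_bddAbove (X : Matrix (Fin d) (Fin d) ℝ) :
    BddAbove (unitQuadraticValues X) := by
  refine ⟨∑ i, ∑ j, |X i j|, ?_⟩
  rintro _ ⟨y, hy, rfl⟩
  have hyi : ∀ i, |y.ofLp i| ≤ 1 := fun i => by
    simpa [hy] using PiLp.norm_apply_le y i
  simp only [dotProduct, Matrix.mulVec, Finset.mul_sum]
  refine Finset.sum_le_sum fun i _ => Finset.sum_le_sum fun j _ => ?_
  calc y.ofLp i * (X i j * y.ofLp j) ≤ |y.ofLp i * (X i j * y.ofLp j)| := le_abs_self _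
    _ = |y.ofLp i| * (|X i j| * |y.ofLp j|) := by rw [abs_mul, abs_mul]
    _ ≤ 1 * (|X i j| * 1) := by gcongr <;> exact hyi _
    _ = |X i j| := by ring

lemma isLUB_sSup_unitQuadraticValues (hd : 1 ≤ d) (X : Matrix (Fin d) (Fin d) ℝ) :
    IsLUB (unitQuadraticValues X) (sSup (unitQuadraticValues X)) :=
  isLUB_csSup (unitQuadraticValues_nonempty hd X) (unitQuadraticValues_bddAbove X)

lemma convexOn_sSup_unitQuadraticValues (hd : 1 ≤ d) (M : Matrix (Fin d) (Fin d) ℝ)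
    (l : Fin d → ℝ) :
    ConvexOn ℝ Set.univ fun t : ℝ => sSup (unitQuadraticValues (expCurve M l t)) := by
  refine ⟨convex_univ, fun x hx y hy a b ha hb hab => ?_⟩
  refine csSup_le (unitQuadraticValues_nonempty hd _) ?_
  rintro _ ⟨z, hz, rfl⟩
  -- A supremum of convex functions: each fixed unit vector `z` gives a convex function, bounded at
  -- `x` and `y` by the suprema there.
  refine ((convexOn_quadratic M l z.ofLp).2 hx hy ha hb hab).trans ?_
  simp only [smul_eq_mul]
  gcongr
  · exact le_csSup (unitQuadraticValues_bddAbove _) ⟨z, hz, rfl⟩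
  · exact le_csSup (unitQuadraticValues_bddAbove _) ⟨z, hz, rfl⟩

end SPD

theorem mainTheorem5 (d : ℕ) (hd : 1 ≤ d) (n : ℕ) (h : Fin d → ℝ) (hs : Fin n → Fin d → ℝ)
    (Y : Matrix (Fin d) (Fin d) ℝ) (hY : Y ∈ SPD.manifold d) :
    ((∃ i, hs i ≠ 0) →
      SPD.GConvexOn (SPD.manifold d) (fun X => Real.log (∑ i, hs i ⬝ᵥ X *ᵥ hs i))) ∧
    SPD.GConvexOn (SPD.manifold d) (fun X => Real.log X.det) ∧
    SPD.GConvexOn (SPD.manifold d) (fun X => h ⬝ᵥ X *ᵥ h) ∧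
    SPD.GConvexOn (SPD.manifold d) (fun X => X.trace) ∧
    SPD.GConvexOn (SPD.manifold d) (fun X => SPD.sDivergence X Y) ∧
    SPD.GConvexOn (SPD.manifold d) (fun X => SPD.dist X Y ^ 2) ∧
    ((∀ X ∈ SPD.manifold d, IsLUB (SPD.unitQuadraticValues X) (sSup (SPD.unitQuadraticValues X))) ∧
      SPD.GConvexOn (SPD.manifold d) (fun X => sSup (SPD.unitQuadraticValues X))) ∧
    SPD.GConvexOn (SPD.manifold d) (fun X => X⁻¹) := by
  refine ⟨fun hx => SPD.gConvexOn_manifold fun M l hM => SPD.convexOn_log_sum_quadratic hM l hx,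
    SPD.gConvexOn_manifold fun M l hM => SPD.convexOn_log_det M hM l,
    SPD.gConvexOn_manifold fun M l _ => SPD.convexOn_quadratic M l h,
    SPD.gConvexOn_manifold fun M l _ => SPD.convexOn_trace M l,
    SPD.gConvexOn_manifold fun M l hM => SPD.convexOn_sDivergence hM l hY,
    SPD.gConvexOn_manifold fun M l hM => SPD.convexOn_dist_sq hM l hY,
    ⟨fun X _ => SPD.isLUB_sSup_unitQuadraticValues hd X,
      SPD.gConvexOn_manifold fun M l _ => SPD.convexOn_sSup_unitQuadraticValues hd M l⟩,
    SPD.gConvexOn_manifold fun M l _ => ?_⟩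
  simp only [SPD.expCurve_inv]
  exact SPD.convexOn_expCurve _ _
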